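/- Let $E$ and $F$ be Banach spaces over the same field $\mathbb K=\mathbb R$ or $\mathbb C$, and suppose there is a quotient mapping $\rho\colon E\to F$, that is, a surjective bounded linear operator such that $\|y\|=\inf\{\|x\|: x\in E,\ \rho(x)=y\}$ for every $y\in F$. For an integer $n\ge 1$ let $\mathcal P(^nE,F)$ be the space of continuous $n$-homogeneous polynomials $P\colon E\to F$ (continuous maps of the form $P(x)=A(x,\dots,x)$ with $A$ symmetric and $n$-linear), with the norm $\|P\|=\sup_{\|x\|\le 1}\|P(x)\|$, and let $\mathcal P_w(^nE,F)$ be the subspace of those $P$ that are weakly continuous on bounded sets, i.e. that map bounded weakly convergent nets of $E$ into norm convergent nets of $F$. A closed subspace $J$ of a Banach space $X$ is an $M$-ideal in $X$ if there is a linear projection $Q\colon X^*\to X^*$ with $\|Q\|\le 1$, whose kernel is $J^\perp=\{x^*\in X^*: x^*(y)=0 \text{ for all } y\in J\}$, such that $\|f\|=\|Qf\|+\|f-Qf\|$ for all $f\in X^*$. If $\mathcal P_w(^nE,F)$ is an $M$-ideal in $\mathcal P(^nE,F)$ for some integer $n\ge 1$, then $F$ (identified with its canonical image) is an $M$-ideal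 in its bidual $F^{**}$. -/

import Mathlib

noncomputable section

open Metric

section Polynomials

variable (𝕜 : Type*) [RCLike 𝕜] (n : ℕ)
  (E : Type*) [NormedAddCommGroup E] [NormedSpace 𝕜 E]
  (F : Type*) [NormedAddCommGroup F] [NormedSpace 𝕜 F]

/-- `P : E → F` is an `n`-homogeneous polynomial: there is a symmetric `n`-linear map `A` with
`P x = A (x, …, x)` for all `x`. -/
def IsHomogeneousPolynomial {E F : Type*} [NormedAddCommGroup E] [NormedSpace 𝕜 E]
    [NormedAddCommGroup F] [NormedSpace 𝕜 F] (P : E → F) : Prop :=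
  ∃ A : MultilinearMap 𝕜 (fun _ : Fin n => E) F,
    (∀ (σ : Equiv.Perm (Fin n)) (v : Fin n → E), A (fun i => v (σ i)) = A v) ∧
      ∀ x, P x = A (fun _ => x)

/-- The continuous `n`-homogeneous polynomials, as a vector space of functions. -/
def continuousPolynomialSubmodule : Submodule 𝕜 (E → F) where
  carrier := {P | IsHomogeneousPolynomial 𝕜 n P ∧ Continuous P}
  zero_mem' := ⟨⟨0, by simp, by simp⟩, continuous_const⟩
  add_mem' := by
    rintro P Q ⟨⟨A, hA, hP⟩, hPc⟩ ⟨⟨B, hB, hQ⟩, hQc⟩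
    exact ⟨⟨A + B, by simp [hA, hB], by simp [hP, hQ]⟩, hPc.add hQc⟩
  smul_mem' := by
    rintro c P ⟨⟨A, hA, hP⟩, hPc⟩
    exact ⟨⟨c • A, by simp [hA], by simp [hP]⟩, hPc.const_smul c⟩

/-- The space `𝓟(ⁿE, F)` of continuous `n`-homogeneous polynomials from `E` to `F`. It is a type of
its own, so that it carries the norm topology defined below and not that of pointwise
convergence. -/
def ContinuousPolynomial : Type _ := continuousPolynomialSubmodule 𝕜 n E F

namespace ContinuousPolynomial

instance : AddCommGroup (ContinuousPolynomial 𝕜 n E F) :=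
  inferInstanceAs (AddCommGroup (continuousPolynomialSubmodule 𝕜 n E F))

instance : Module 𝕜 (ContinuousPolynomial 𝕜 n E F) :=
  inferInstanceAs (Module 𝕜 (continuousPolynomialSubmodule 𝕜 n E F))

instance : FunLike (ContinuousPolynomial 𝕜 n E F) E F where
  coe P := P.1
  coe_injective _ _ h := Subtype.ext h

variable {𝕜 n E F}

@[simp] theorem zero_apply (x : E) : (0 : ContinuousPolynomial 𝕜 n E F) x = 0 := rfl

@[simp] theorem add_apply (P Q : ContinuousPolynomial 𝕜 n E F) (x : E) :
    (P + Q) x = P x + Q x := rfl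

@[simp] theorem smul_apply (c : 𝕜) (P : ContinuousPolynomial 𝕜 n E F) (x : E) :
    (c • P) x = c • P x := rfl

theorem map_smul_pow (P : ContinuousPolynomial 𝕜 n E F) (c : 𝕜) (x : E) :
    P (c • x) = c ^ n • P x := by
  obtain ⟨A, -, hA⟩ := P.2.1
  change P.1 (c • x) = c ^ n • P.1 x
  rw [hA, hA]
  simpa using A.map_smul_univ (fun _ => c) (fun _ => x)

theorem exists_bound (P : ContinuousPolynomial 𝕜 n E F) :
    ∃ C : ℝ, ∀ x ∈ closedBall (0 : E) 1, ‖P x‖ ≤ C := by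
  obtain ⟨δ, hδ, h⟩ := Metric.continuous_iff.1 P.2.2 0 1 one_pos
  have hδ2 : 0 < δ / 2 := by positivity
  refine ⟨(‖P 0‖ + 1) / (δ / 2) ^ n, fun x hx => ?_⟩
  have hx1 : ‖x‖ ≤ 1 := by simpa using hx
  have h1 : dist (P (((δ / 2 : ℝ) : 𝕜) • x)) (P 0) < 1 := by
    refine h _ ?_
    rw [dist_zero_right, norm_smul, RCLike.norm_ofReal, abs_of_pos hδ2]
    nlinarith
  have h2 : ‖P (((δ / 2 : ℝ) : 𝕜) • x)‖ ≤ ‖P 0‖ + 1 := by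
    rw [dist_eq_norm] at h1
    have := norm_le_norm_add_norm_sub' (P (((δ / 2 : ℝ) : 𝕜) • x)) (P 0)
    linarith
  rw [map_smul_pow, norm_smul, norm_pow, RCLike.norm_ofReal, abs_of_pos hδ2] at h2
  rw [le_div_iff₀ (by positivity)]
  linarith

/-- The supremum norm over the closed unit ball. -/
instance : Norm (ContinuousPolynomial 𝕜 n E F) where
  norm P := sSup ((fun x => ‖P x‖) '' closedBall (0 : E) 1)

theorem norm_def (P : ContinuousPolynomial 𝕜 n E F) :
    ‖P‖ = sSup ((fun x => ‖P x‖) '' closedBall (0 : E) 1) := rfl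

/-- The supremum defining the norm is a genuine one. -/
theorem isLUB_norm (P : ContinuousPolynomial 𝕜 n E F) :
    IsLUB ((fun x => ‖P x‖) '' closedBall (0 : E) 1) ‖P‖ := by
  refine isLUB_csSup ⟨‖P 0‖, 0, by simp, rfl⟩ ?_
  obtain ⟨C, hC⟩ := P.exists_bound
  exact ⟨C, by rintro _ ⟨x, hx, rfl⟩; exact hC x hx⟩

theorem norm_apply_le (P : ContinuousPolynomial 𝕜 n E F) {x : E} (hx : ‖x‖ ≤ 1) :
    ‖P x‖ ≤ ‖P‖ :=
  P.isLUB_norm.1 ⟨x, by simpa using hx, rfl⟩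

theorem norm_le {P : ContinuousPolynomial 𝕜 n E F} {C : ℝ}
    (h : ∀ x : E, ‖x‖ ≤ 1 → ‖P x‖ ≤ C) : ‖P‖ ≤ C :=
  P.isLUB_norm.2 (by rintro _ ⟨x, hx, rfl⟩; exact h x (by simpa using hx))

theorem normCore : NormedSpace.Core 𝕜 (ContinuousPolynomial 𝕜 n E F) where
  norm_nonneg P := (norm_nonneg (P 0)).trans (P.norm_apply_le (by simp))
  norm_smul c P := by
    refine le_antisymm (norm_le fun x hx => ?_) ?_
    · rw [smul_apply, _root_.norm_smul]
      exact mul_le_mul_of_nonneg_left (P.norm_apply_le hx) (norm_nonneg c)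
    · rcases eq_or_ne c 0 with rfl | hc
      · rw [norm_zero, zero_mul]
        exact (norm_nonneg _).trans (norm_apply_le ((0 : 𝕜) • P) (x := 0) (by simp))
      · have hc' : 0 < ‖c‖ := norm_pos_iff.2 hc
        rw [← le_div_iff₀' hc']
        refine norm_le fun x hx => ?_
        rw [le_div_iff₀' hc', ← _root_.norm_smul, ← smul_apply]
        exact norm_apply_le _ hx
  norm_triangle P Q := norm_le fun x hx =>
    (norm_add_le (P x) (Q x)).trans (add_le_add (P.norm_apply_le hx) (Q.norm_apply_le hx))
  norm_eq_zero_iff P := by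
    refine ⟨fun h => DFunLike.ext _ _ fun x => ?_, ?_⟩
    · have hr : (0 : ℝ) < (‖x‖ + 1)⁻¹ := by positivity
      have hy : ‖(((‖x‖ + 1)⁻¹ : ℝ) : 𝕜) • x‖ ≤ 1 := by
        rw [_root_.norm_smul, RCLike.norm_ofReal, abs_of_pos hr, inv_mul_le_iff₀ (by positivity)]
        linarith
      have h0 : P ((((‖x‖ + 1)⁻¹ : ℝ) : 𝕜) • x) = 0 :=
        norm_le_zero_iff.1 ((P.norm_apply_le hy).trans h.le)
      rw [map_smul_pow] at h0
      exact (smul_eq_zero.1 h0).resolve_left (pow_ne_zero _ (RCLike.ofReal_ne_zero.2 hr.ne'))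
    · rintro rfl
      exact le_antisymm (norm_le fun x _ => by simp)
        ((norm_nonneg _).trans (norm_apply_le (0 : ContinuousPolynomial 𝕜 n E F) (x := 0)
          (by simp)))

instance : NormedAddCommGroup (ContinuousPolynomial 𝕜 n E F) :=
  NormedAddCommGroup.ofCore (𝕜 := 𝕜) normCore

instance : NormedSpace 𝕜 (ContinuousPolynomial 𝕜 n E F) where
  norm_smul_le c P := (normCore.norm_smul c P).le

variable (𝕜 n E F)

/-- The subspace `𝓟_w(ⁿE, F)` of polynomials that are weakly continuous on bounded sets: whenever
`x` runs through a bounded net (a filter containing a bounded set) that converges weakly in `E`,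
`P x` converges in the norm of `F`. -/
def weaklyContinuousOnBounded : Submodule 𝕜 (ContinuousPolynomial 𝕜 n E F) where
  carrier := {P | ∀ (l : Filter E) (x₀ : E), (∃ B ∈ l, Bornology.IsBounded B) →
    Filter.Tendsto (fun x => toWeakSpace 𝕜 E x) l (nhds (toWeakSpace 𝕜 E x₀)) →
      ∃ y : F, Filter.Tendsto P l (nhds y)}
  zero_mem' := fun _ _ _ _ => ⟨0, tendsto_const_nhds⟩
  add_mem' := fun hP hQ l x₀ hB hl => by
    obtain ⟨y, hy⟩ := hP l x₀ hB hl
    obtain ⟨z, hz⟩ := hQ l x₀ hB hl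
    exact ⟨y + z, hy.add hz⟩
  smul_mem' := fun c _ hP l x₀ hB hl => by
    obtain ⟨y, hy⟩ := hP l x₀ hB hl
    exact ⟨c • y, hy.const_smul c⟩

end ContinuousPolynomial

end Polynomials

section Ideals

variable {𝕜 : Type*} [RCLike 𝕜] {X : Type*} [NormedAddCommGroup X] [NormedSpace 𝕜 X]

/-- `Q` is a contractive linear projection on the dual `X*` whose kernel is the annihilator
of `J`. (For `J ≠ 0` its norm is then exactly one; for `J = 0` it is the zero map.) -/
structure IsIdealProjection (J : Submodule 𝕜 X)
    (Q : StrongDual 𝕜 X →L[𝕜] StrongDual 𝕜 X) : Prop where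
  proj : ∀ f, Q (Q f) = Q f
  norm_le_one : ‖Q‖ ≤ 1
  ker_eq : ∀ f, Q f = 0 ↔ ∀ y ∈ J, f y = 0

variable (𝕜 X) in
/-- The closed subspace `J` is an `M`-ideal in `X`. -/
def IsMIdeal (J : Submodule 𝕜 X) : Prop :=
  IsClosed (J : Set X) ∧ ∃ Q : StrongDual 𝕜 X →L[𝕜] StrongDual 𝕜 X,
    IsIdealProjection J Q ∧ ∀ f, ‖f‖ = ‖Q f‖ + ‖f - Q f‖

end Ideals

/-- A quotient mapping between normed spaces: a surjective bounded operator for which the norm of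
`F` is the quotient norm of `E ⧸ ker ρ`. -/
def IsQuotientMapping {𝕜 : Type*} [RCLike 𝕜] {E : Type*} [NormedAddCommGroup E] [NormedSpace 𝕜 E]
    {F : Type*} [NormedAddCommGroup F] [NormedSpace 𝕜 F] (ρ : E →L[𝕜] F) : Prop :=
  (AddMonoidHom.mkNormedAddGroupHom (ρ : E →+ F) ‖ρ‖ ρ.le_opNorm).IsQuotient

end

/-! Restriction to $F$ always gives a contractive projection of $F^{***}$ onto $F^*$ with kernel
$F^\perp$. What is needed is $\|g\|+\|k\|\le\|g+k\|$ for $g\in F^*$, $k\in F^\perp$. This follows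
if, for $\|\Phi\|=1$ in $F^{**}$, $\|y\|\le 1$ in $F$, $g\in F^*$ and $\varepsilon>0$, some $q\in F$
satisfies $\|y+\Phi-q\|\le 1+\varepsilon$ and $|g(q)-\Phi(g)|\le\varepsilon$.

Such a $q$ comes from polynomials. By Goldstine's theorem and the quotient map, an ultrafilter $U$
on the unit ball of $E$ satisfies $\rho(x)\to\Phi$ weak-star. Choose $\|\varphi\|\le 1$ with
$\Phi(\varphi)$ close to 1. Along $U$, the polynomial $(\varphi\circ\rho)^n y$, which lies in
$\mathcal P_w$, tends nearly to $y$, and $(\varphi\circ\rho)^{n-1}\rho$ tends weak-star nearly to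
$\Phi$. The functional $f(P)=\lim_U g(P(x))$ is fixed by the $M$-ideal projection. Hence
`IsIdealProjection.exists_norm_add_sub_lt` corrects the sum of the two polynomials by some
$R\in\mathcal P_w$, with controlled $f(R)$. Although $U$ need not converge weakly in $E$,
`WeaklyContinuousOnBounded.cauchy_map` makes $R$ converge in norm along it, and the limit is $q$. -/

open Metric Filter Topology

/-! ### Hahn–Banach separation, Goldstine's theorem and approximation in $M$-ideals -/

section Functionals

variable {𝕜 : Type*} [RCLike 𝕜] {X : Type*} [NormedAddCommGroup X] [NormedSpace 𝕜 X]

theorem exists_apply_eq_ofReal_of_lt_opNorm (G : StrongDual 𝕜 X) {r : ℝ} (hr : r < ‖G‖) :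
    ∃ x : X, ‖x‖ < 1 ∧ ∃ t : ℝ, r < t ∧ G x = (t : 𝕜) := by
  obtain ⟨x, hx, h⟩ := G.exists_lt_apply_of_lt_opNorm hr
  obtain ⟨c, hc, hcx⟩ := RCLike.exists_norm_eq_mul_self (G x)
  refine ⟨c • x, by rwa [norm_smul, hc, one_mul], ‖G x‖, h, ?_⟩
  rw [map_smul, smul_eq_mul, hcx]

theorem opNorm_le_of_re_le (G : StrongDual 𝕜 X) {r : ℝ}
    (h : ∀ x : X, ‖x‖ < 1 → RCLike.re (G x) ≤ r) : ‖G‖ ≤ r := by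
  by_contra! hr
  obtain ⟨x, hx, t, ht, hGx⟩ := exists_apply_eq_ofReal_of_lt_opNorm G hr
  have := h x hx
  rw [hGx, RCLike.ofReal_re] at this
  linarith

/-- **Goldstine's theorem**: the unit ball is weak-star dense in the unit ball of the bidual. -/
theorem coe_mem_closure_image_ball (φ : StrongDual 𝕜 (StrongDual 𝕜 X)) (hφ : ‖φ‖ ≤ 1) :
    (φ : StrongDual 𝕜 X → 𝕜) ∈
      closure ((fun (x : X) (g : StrongDual 𝕜 X) => g x) '' ball (0 : X) 1) := by
  classical
  let _ : NormedSpace ℝ X := NormedSpace.restrictScalars ℝ 𝕜 X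
  have : IsScalarTower ℝ 𝕜 X :=
    IsScalarTower.of_algebraMap_smul fun _ _ => rfl
  rw [_root_.mem_closure_iff]
  intro u hu hφu
  obtain ⟨I, v, hv, hvu⟩ := isOpen_pi_iff.1 hu _ hφu
  -- Only finitely many coordinates matter, so separation takes place in `I → 𝕜`; the separating
  -- functional pulls back along `T` to an element `G` of the dual, on which `φ` would exceed `‖G‖`.
  let T : X →ₗ[𝕜] (I → 𝕜) := LinearMap.pi fun g => (g.1 : X →ₗ[𝕜] 𝕜)
  let p : I → 𝕜 := fun g => φ g.1
  have hp : p ∈ closure (T '' ball (0 : X) 1) := by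
    by_contra hp
    have hconv : Convex ℝ (closure (T '' ball (0 : X) 1)) :=
      ((convex_ball (0 : X) 1).linear_image (T.restrictScalars ℝ)).closure
    obtain ⟨Λ, s, hs, hsp⟩ :=
      RCLike.geometric_hahn_banach_closed_point (𝕜 := 𝕜) hconv isClosed_closure hp
    let G : StrongDual 𝕜 X := ∑ g : I, Λ (Pi.single g 1) • g.1
    have hΛ : ∀ w : I → 𝕜, Λ w = ∑ g : I, w g • Λ (Pi.single g 1) := fun w =>
      LinearMap.pi_apply_eq_sum_univ (Λ : (I → 𝕜) →ₗ[𝕜] 𝕜) w |>.trans (by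
        refine Finset.sum_congr rfl fun g _ => ?_
        have : (Pi.single g 1 : I → 𝕜) = fun j => if g = j then 1 else 0 := by
          ext j
          simp [Pi.single_apply, eq_comm]
        rw [this]
        rfl)
    have hG : ‖G‖ ≤ s := opNorm_le_of_re_le G fun x hx => by
      have h1 := hs (T x) (subset_closure ⟨x, by simpa using hx, rfl⟩)
      rw [hΛ] at h1
      have h2 : G x = ∑ g : I, T x g • Λ (Pi.single g 1) := by
        simp [G, T, mul_comm]
      rw [h2]
      exact h1.le
    have h3 : Λ p = φ G := by
      rw [hΛ]
      simp [G, p, mul_comm]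
    have h4 : RCLike.re (φ G) ≤ ‖G‖ :=
      (RCLike.re_le_norm _).trans ((φ.le_opNorm G).trans
        (mul_le_of_le_one_left (norm_nonneg _) hφ))
    rw [h3] at hsp
    linarith
  have hopen : IsOpen (Set.univ.pi fun g : I => v g.1) :=
    isOpen_set_pi Set.finite_univ fun g _ => (hv g.1 g.2).1
  obtain ⟨_, hx, x, hxb, rfl⟩  := _root_.mem_closure_iff.1 hp _ hopen fun g _ => (hv g.1 g.2).2
  exact ⟨_, hvu fun g hg => hx ⟨g, hg⟩ trivial, x, hxb, rfl⟩

theorem exists_ultrafilter_tendsto_bidual (φ : StrongDual 𝕜 (StrongDual 𝕜 X)) (hφ : ‖φ‖ ≤ 1) :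
    ∃ U : Ultrafilter X, (∀ᶠ x in (U : Filter X), ‖x‖ < 1) ∧
      ∀ g : StrongDual 𝕜 X, Tendsto g U (𝓝 (φ g)) := by
  obtain ⟨V, hV, hφV⟩ := mem_closure_iff_ultrafilter.1 (coe_mem_closure_image_ball φ hφ)
  obtain ⟨U, hU, rfl⟩ : ∃ U : Ultrafilter X, ball (0 : X) 1 ∈ U ∧
      U.map (fun (x : X) (g : StrongDual 𝕜 X) => g x) = V := by
    have : (comap (fun (x : X) (g : StrongDual 𝕜 X) => g x) V ⊓ 𝓟 (ball (0 : X) 1)).NeBot := by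
      rw [← forall_mem_nonempty_iff_neBot]
      intro s hs
      obtain ⟨t, ht, hts⟩ := mem_inf_principal.1 hs
      obtain ⟨_, hxt, x, hx, rfl⟩ := V.nonempty_of_mem (inter_mem ht hV)
      exact ⟨x, hts hxt hx⟩
    obtain ⟨U, hU⟩ := Ultrafilter.exists_le
      (comap (fun (x : X) (g : StrongDual 𝕜 X) => g x) V ⊓ 𝓟 (ball (0 : X) 1))
    refine ⟨U, le_principal_iff.1 (hU.trans inf_le_right), Ultrafilter.coe_le_coe.1 ?_⟩
    exact map_le_iff_le_comap.2 (hU.trans inf_le_left)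
  refine ⟨U, by filter_upwards [hU] with x hx using by simpa using hx, fun g => ?_⟩
  exact tendsto_pi_nhds.1 (show Tendsto (fun (x : X) (g : StrongDual 𝕜 X) => g x) U
    (𝓝 (φ : StrongDual 𝕜 X → 𝕜)) from hφV) g

theorem forall_eq_zero_of_bddBelow_re {V : Type*} [AddCommGroup V] [Module 𝕜 V]
    (L : V →ₗ[𝕜] 𝕜) (c : ℝ) (h : ∀ z, c ≤ RCLike.re (L z)) (z : V) : L z = 0 := by
  by_contra hz
  have := h ((((c - 1 : ℝ) : 𝕜) / L z) • z)
  rw [map_smul, smul_eq_mul, div_mul_cancel₀ _ hz, RCLike.ofReal_re] at this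
  linarith

/-- Otherwise Hahn–Banach separates the affine set of pairs $(y+x-z,\ f(z)-Qf(x))$, $z\in J$, from a
product of balls by a functional $(G,s)$. Being bounded below on $J$ forces $sf=G$ there, hence
$sQf=QG$. The separating value is then at most $|QG(y)|+|(G-QG)(x)|\le\|G\|$, but at least
$(1+\varepsilon)\|G\|$. -/
theorem IsIdealProjection.exists_norm_add_sub_lt {J : Submodule 𝕜 X}
    {Q : StrongDual 𝕜 X →L[𝕜] StrongDual 𝕜 X} (hQ : IsIdealProjection J Q)
    (hM : ∀ f, ‖f‖ = ‖Q f‖ + ‖f - Q f‖) {x y : X} (hx : ‖x‖ ≤ 1) (hy : ‖y‖ ≤ 1) (hyJ : y ∈ J)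
    (f : StrongDual 𝕜 X) {ε : ℝ} (hε : 0 < ε) :
    ∃ z ∈ J, ‖y + x - z‖ < 1 + ε ∧ ‖f z - Q f x‖ < ε := by
  let _ : NormedSpace ℝ X := NormedSpace.restrictScalars ℝ 𝕜 X
  have : IsScalarTower ℝ 𝕜 X :=
    IsScalarTower.of_algebraMap_smul fun _ _ => rfl
  by_contra! hcon
  let A : Set (X × 𝕜) := Set.range fun z : J => (y + x - z, f z - Q f x)
  let C : Set (X × 𝕜) := ball 0 (1 + ε) ×ˢ ball 0 ε
  have hA : Convex ℝ A := by
    rintro _ ⟨z, rfl⟩ _ ⟨w, rfl⟩ a b - - hab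
    refine ⟨(a : 𝕜) • z + (b : 𝕜) • w, ?_⟩
    have hab' : (a : 𝕜) + (b : 𝕜) = 1 := by exact_mod_cast congrArg (RCLike.ofReal (K := 𝕜)) hab
    obtain rfl : b = 1 - a := by linarith
    ext
    · simp only [Prod.fst_add, Prod.smul_fst, Submodule.coe_add, Submodule.coe_smul,
        RCLike.real_smul_eq_coe_smul (K := 𝕜), RCLike.ofReal_sub, RCLike.ofReal_one]
      module
    · simp only [Prod.snd_add, Prod.smul_snd, Submodule.coe_add, Submodule.coe_smul, map_add,
        map_smul, RCLike.real_smul_eq_coe_smul (K := 𝕜), RCLike.ofReal_sub, RCLike.ofReal_one]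
      module
  have hC : Convex ℝ C := (convex_ball _ _).prod (convex_ball _ _)
  have hCo : IsOpen C := isOpen_ball.prod isOpen_ball
  have hdisj : Disjoint C A := by
    rw [Set.disjoint_left]
    rintro _ ⟨h1, h2⟩ ⟨z, rfl⟩
    simp only [mem_ball_zero_iff] at h1 h2
    exact absurd h2 (hcon z z.2 h1).not_gt
  obtain ⟨Λ, r, hr, hrA⟩ := RCLike.geometric_hahn_banach_open (𝕜 := 𝕜) hC hCo hA hdisj
  let G : StrongDual 𝕜 X := Λ.comp (ContinuousLinearMap.inl 𝕜 X 𝕜)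
  let s : 𝕜 := Λ (0, 1)
  have hΛ : ∀ u t, Λ (u, t) = G u + t * s := fun u t => by
    have : ((u, t) : X × 𝕜) = (u, 0) + t • (0, 1) := by simp
    rw [this, map_add, map_smul, smul_eq_mul]
    rfl
  have hr0 : 0 < r := by
    have := hr 0 ⟨by simp; linarith, by simpa using hε⟩
    simpa using this
  have hG : (1 + ε) * ‖G‖ ≤ r := by
    rw [← le_div_iff₀' (by linarith)]
    refine opNorm_le_of_re_le G fun u hu => ?_
    rw [le_div_iff₀' (by linarith)]
    have h1 : ‖((1 + ε : ℝ) : 𝕜) • u‖ < 1 + ε := by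
      rw [norm_smul, RCLike.norm_ofReal, abs_of_pos (by linarith)]
      nlinarith
    have := hr (((1 + ε : ℝ) : 𝕜) • u, 0) ⟨by simpa using h1, by simpa using hε⟩
    rw [hΛ, zero_mul, add_zero, map_smul, smul_eq_mul, RCLike.re_ofReal_mul] at this
    exact this.le
  have hval : ∀ z : J, r ≤ RCLike.re (G (y + x) - s * Q f x) +
      RCLike.re ((s • f - G).toLinearMap.comp J.subtype z) := fun z => by
    have := hrA _ ⟨z, rfl⟩
    rw [hΛ] at this
    refine this.trans_eq ?_
    rw [← map_add]
    congr 1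
    simp
    ring
  have hker : ∀ z ∈ J, (s • f - G) z = 0 := fun z hz =>
    forall_eq_zero_of_bddBelow_re ((s • f - G).toLinearMap.comp J.subtype)
      (r - RCLike.re (G (y + x) - s * Q f x)) (fun z => by linarith [hval z]) ⟨z, hz⟩
  have hQG : s • Q f = Q G := by
    have := (hQ.ker_eq _).2 hker
    rwa [map_sub, map_smul, sub_eq_zero] at this
  have hGy : (G - Q G) y = 0 := by
    refine (hQ.ker_eq (G - Q G)).1 ?_ y hyJ
    rw [map_sub, hQ.proj, sub_self]
  have hle : r ≤ ‖G‖ := by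
    have h0 := hval 0
    rw [map_zero, map_zero, add_zero] at h0
    have h1 : G (y + x) - s * Q f x = Q G y + (G - Q G) x := by
      have h2 : s * Q f x = Q G x := by rw [← hQG]; rfl
      have h3 : G y = Q G y := by simpa [sub_eq_zero] using hGy
      rw [map_add, h2, h3, sub_apply]
      ring
    rw [h1] at h0
    refine h0.trans ((RCLike.re_le_norm _).trans ((norm_add_le _ _).trans ?_))
    rw [hM G]
    exact add_le_add ((Q G).unit_le_opNorm y hy) ((G - Q G).unit_le_opNorm x hx)
  nlinarith

end Functionals

/-! ### Polynomial degree through finite differences -/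

section FiniteDifferences

/-- `f` is a polynomial map of degree at most `n` in the sense of Fréchet: `n + 1` successive
differences of `f` vanish. -/
def HasDifferenceDegreeLE {E F : Type*} [AddCommGroup E] [AddCommGroup F] : ℕ → (E → F) → Prop
  | 0, f => ∀ x y, f x = f y
  | n + 1, f => ∀ v, HasDifferenceDegreeLE n fun x => f x - f (x - v)

namespace HasDifferenceDegreeLE

variable {E F : Type*} [AddCommGroup E] [AddCommGroup F]

theorem const (n : ℕ) (c : F) : HasDifferenceDegreeLE n fun _ : E => c := by
  induction n generalizing c with
  | zero => exact fun _ _ => rfl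
  | succ n ih => exact fun v => ih (c - c)

theorem succ {n : ℕ} {f : E → F} (hf : HasDifferenceDegreeLE n f) :
    HasDifferenceDegreeLE (n + 1) f := by
  induction n generalizing f with
  | zero => exact fun v x y => by simp [hf x (x - v), hf y (y - v)]
  | succ n ih => exact fun v => ih (hf v)

theorem mono {m n : ℕ} (hmn : m ≤ n) {f : E → F} (hf : HasDifferenceDegreeLE m f) :
    HasDifferenceDegreeLE n f := by
  induction n, hmn using Nat.le_induction with
  | base => exact hf
  | succ n _ ih => exact ih.succ

theorem add {n : ℕ} {f g : E → F} (hf : HasDifferenceDegreeLE n f)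
    (hg : HasDifferenceDegreeLE n g) : HasDifferenceDegreeLE n fun x => f x + g x := by
  induction n generalizing f g with
  | zero => exact fun x y => by simp only [hf x y, hg x y]
  | succ n ih =>
    intro v
    convert ih (hf v) (hg v) using 2
    beta_reduce
    abel

theorem neg {n : ℕ} {f : E → F} (hf : HasDifferenceDegreeLE n f) :
    HasDifferenceDegreeLE n fun x => -f x := by
  induction n generalizing f with
  | zero => exact fun x y => by simp only [hf x y]
  | succ n ih =>
    intro v
    convert ih (hf v) using 2
    beta_reduce
    abel

theorem sum {n : ℕ} {ι : Type*} {s : Finset ι} {f : ι → E → F}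
    (hf : ∀ i ∈ s, HasDifferenceDegreeLE n (f i)) :
    HasDifferenceDegreeLE n fun x => ∑ i ∈ s, f i x := by
  classical
  induction s using Finset.induction_on with
  | empty => simpa using const n (0 : F)
  | insert a s ha ih =>
    simp only [Finset.sum_insert ha]
    exact (hf a (by simp)).add (ih fun i hi => hf i (by simp [hi]))

end HasDifferenceDegreeLE

/-- Expanding in the slots of `t`, the term with `x` in all of them cancels in the difference, and
every other term has fewer slots with `x`. Those terms have `-v` in the freed slots, so the
induction needs arbitrary frozen entries `c`. -/
theorem MultilinearMap.hasDifferenceDegreeLE_piecewise {R ι E F : Type*} [CommRing R]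
    [AddCommGroup E] [Module R E] [AddCommGroup F] [Module R F] [DecidableEq ι]
    (A : MultilinearMap R (fun _ : ι => E) F) (n : ℕ) (t : Finset ι) (ht : t.card ≤ n)
    (c : ι → E) : HasDifferenceDegreeLE n fun x => A (t.piecewise (fun _ => x) c) := by
  induction n generalizing t c with
  | zero =>
    rw [Nat.le_zero, Finset.card_eq_zero] at ht
    subst ht
    exact fun x y => by simp
  | succ n ih =>
    intro v
    have key : ∀ x, A (t.piecewise (fun _ => x) c) - A (t.piecewise (fun _ => x - v) c) =
        -∑ s ∈ t.powerset.erase t,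
          A (s.piecewise (fun _ => x) (t.piecewise (fun _ => -v) c)) := by
      intro x
      have h := A.map_piecewise_add (fun _ => x) (t.piecewise (fun _ => -v) c) t
      have h1 : t.piecewise ((fun _ => x) + t.piecewise (fun _ => -v) c)
          (t.piecewise (fun _ => -v) c) = t.piecewise (fun _ => x - v) c := by
        ext i
        by_cases hi : i ∈ t <;> simp [hi, sub_eq_add_neg]
      have h2 : t.piecewise (fun _ => x) (t.piecewise (fun _ => -v) c) =
          t.piecewise (fun _ => x) c := by
        ext i
        by_cases hi : i ∈ t <;> simp [hi]
      rw [h1, ← Finset.add_sum_erase _ _ (Finset.mem_powerset_self t), h2] at h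
      rw [h]
      abel
    simp only [key]
    refine (HasDifferenceDegreeLE.sum fun s hs => ih s ?_ _).neg
    obtain ⟨hne, hs⟩ := Finset.mem_erase.1 hs
    have := Finset.card_lt_card ((Finset.mem_powerset.1 hs).ssubset_of_ne hne)
    omega

end FiniteDifferences

/-! ### Weakly continuous polynomials along weakly Cauchy filters -/

section WeakContinuity

variable (𝕜 : Type*) [RCLike 𝕜] {E : Type*} [NormedAddCommGroup E] [NormedSpace 𝕜 E]
  {F : Type*} [NormedAddCommGroup F]

/-- `f` maps bounded weakly convergent filters to norm convergent ones. -/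
def WeaklyContinuousOnBounded (f : E → F) : Prop :=
  ∀ (l : Filter E) (x₀ : E), (∃ B ∈ l, Bornology.IsBounded B) →
    Tendsto (fun x => toWeakSpace 𝕜 E x) l (𝓝 (toWeakSpace 𝕜 E x₀)) →
      ∃ y : F, Tendsto f l (𝓝 y)

variable {𝕜}

theorem tendsto_toWeakSpace_iff {α : Type*} {l : Filter α} {u : α → E} {x₀ : E} :
    Tendsto (fun a => toWeakSpace 𝕜 E (u a)) l (𝓝 (toWeakSpace 𝕜 E x₀)) ↔
      ∀ φ : StrongDual 𝕜 E, Tendsto (fun a => φ (u a)) l (𝓝 (φ x₀)) :=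
  WeakBilin.tendsto_iff_forall_eval_tendsto (topDualPairing 𝕜 E).flip
    fun _ _ h => (SeparatingDual.eq_iff_forall_dual_eq (R := 𝕜)).2 fun φ => LinearMap.congr_fun h φ

theorem WeaklyContinuousOnBounded.sub_translate {f : E → F}
    (hf : WeaklyContinuousOnBounded 𝕜 f) (v : E) :
    WeaklyContinuousOnBounded 𝕜 fun x => f x - f (x - v) := by
  intro l x₀ hB hl
  obtain ⟨y, hy⟩ := hf l x₀ hB hl
  obtain ⟨B, hBl, hB⟩ := hB
  obtain ⟨z, hz⟩ := hf (l.map fun x => x - v) (x₀ - v)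
    ⟨(fun x => x - v) '' B, image_mem_map hBl, by
      obtain ⟨R, hR⟩ := isBounded_iff_forall_norm_le.1 hB
      refine isBounded_iff_forall_norm_le.2 ⟨R + ‖v‖, ?_⟩
      rintro _ ⟨x, hx, rfl⟩
      exact (norm_sub_le _ _).trans (by gcongr; exact hR x hx)⟩ (by
      rw [tendsto_map'_iff]
      refine tendsto_toWeakSpace_iff.2 fun φ => ?_
      simpa using (tendsto_toWeakSpace_iff.1 hl φ).sub_const (φ v))
  exact ⟨y - z, hy.sub (tendsto_map'_iff.1 hz)⟩

/-- Differences $x-v$ along $l\times l$ are bounded and weakly null, so $f(x-v)$ converges even if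
$l$ has no weak limit. Fixing a suitable $v$, write $f(x)=(f(x)-f(x-v))+f(x-v)$: the first term has
lower degree and is Cauchy by induction, and the second is nearly constant. -/
theorem WeaklyContinuousOnBounded.cauchy_map {n : ℕ} {f : E → F}
    (hf : WeaklyContinuousOnBounded 𝕜 f) (hn : HasDifferenceDegreeLE n f) {l : Filter E} [l.NeBot]
    {r : ℝ} (hl : ∀ᶠ x in l, ‖x‖ ≤ r) (hc : ∀ φ : StrongDual 𝕜 E, Cauchy (l.map φ)) :
    Cauchy (l.map f) := by
  induction n generalizing f with
  | zero =>
    rw [show f = fun _ => f 0 from funext fun x => hn x 0]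
    exact (tendsto_const_nhds (x := f 0)).cauchy_map
  | succ n ih =>
    obtain ⟨y, hy⟩ := hf (comap (toWeakSpace 𝕜 E) (𝓝 (toWeakSpace 𝕜 E 0)) ⊓
      𝓟 (closedBall 0 (2 * r))) 0 ⟨_, mem_inf_of_right (mem_principal_self _), isBounded_closedBall⟩
      (tendsto_comap.mono_left inf_le_left)
    have hdiff : Tendsto (fun p : E × E => p.1 - p.2) (l ×ˢ l)
        (comap (toWeakSpace 𝕜 E) (𝓝 (toWeakSpace 𝕜 E 0)) ⊓ 𝓟 (closedBall 0 (2 * r))) := by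
      refine tendsto_inf.2 ⟨tendsto_comap_iff.2 (tendsto_toWeakSpace_iff.2 fun φ => ?_),
        tendsto_principal.2 ?_⟩
      · have h := (cauchy_map_iff.1 (hc φ)).2
        rw [uniformity_eq_comap_nhds_zero_swapped, tendsto_comap_iff] at h
        simpa [Function.comp_def] using h
      · filter_upwards [hl.prod_mk hl] with p hp
        rw [mem_closedBall_zero_iff]
        linarith [norm_sub_le p.1 p.2, hp.1, hp.2]
    rw [Metric.cauchy_iff]
    refine ⟨inferInstance, fun ε hε => ?_⟩
    obtain ⟨A, hA, hAf⟩ := mem_prod_same_iff.1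
      ((hy.comp hdiff).eventually (ball_mem_nhds y (show 0 < ε / 3 by linarith)))
    obtain ⟨v, hv⟩ := nonempty_of_mem hA
    obtain ⟨B, hB, hBd⟩ := (Metric.cauchy_iff.1 (ih (hf.sub_translate v) (hn v))).2 (ε / 3)
      (by linarith)
    refine ⟨f '' (A ∩ {x | f x - f (x - v) ∈ B}), image_mem_map (inter_mem hA hB), ?_⟩
    rintro _ ⟨x, ⟨hxA, hxB⟩, rfl⟩ _ ⟨z, ⟨hzA, hzB⟩, rfl⟩
    have h1 : dist (f (x - v)) y < ε / 3 := @hAf (x, v) ⟨hxA, hv⟩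
    have h2 : dist (f (z - v)) y < ε / 3 := @hAf (z, v) ⟨hzA, hv⟩
    have h3 := hBd _ hxB _ hzB
    rw [dist_eq_norm] at *
    calc ‖f x - f z‖ = ‖(f x - f (x - v) - (f z - f (z - v))) +
          ((f (x - v) - y) - (f (z - v) - y))‖ := by congr 1; abel
      _ ≤ _ + (_ + _) := (norm_add_le _ _).trans (add_le_add le_rfl (norm_sub_le _ _))
      _ < ε := by linarith

theorem ContinuousPolynomial.hasDifferenceDegreeLE [NormedSpace 𝕜 F] {n : ℕ}
    (P : ContinuousPolynomial 𝕜 n E F) : HasDifferenceDegreeLE n P := by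
  obtain ⟨A, -, hA⟩ := P.2.1
  have := A.hasDifferenceDegreeLE_piecewise n Finset.univ (by simp) 0
  simp only [Finset.piecewise_univ, ← hA] at this
  exact this

end WeakContinuity

/-! ### From the $M$-ideal of polynomials to approximation in the bidual -/

section HomogeneousPolynomials

variable {𝕜 : Type*} [RCLike 𝕜] {n : ℕ}
  {E : Type*} [NormedAddCommGroup E] [NormedSpace 𝕜 E]
  {F : Type*} [NormedAddCommGroup F] [NormedSpace 𝕜 F]

/-- The diagonal of a multilinear map that is not necessarily symmetric is a homogeneous
polynomial. -/
theorem MultilinearMap.isHomogeneousPolynomial (A : MultilinearMap 𝕜 (fun _ : Fin n => E) F) :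
    IsHomogeneousPolynomial 𝕜 n fun x => A fun _ => x := by
  refine ⟨((n.factorial : 𝕜)⁻¹) • ∑ σ : Equiv.Perm (Fin n), A.domDomCongr σ, fun τ v => ?_,
    fun x => ?_⟩
  · simp only [smul_apply, sum_apply,
      MultilinearMap.domDomCongr_apply]
    congr 1
    exact Fintype.sum_equiv (Equiv.mulLeft τ) _ _ fun σ => rfl
  · have h : (n.factorial : 𝕜) ≠ 0 := Nat.cast_ne_zero.2 n.factorial_ne_zero
    simp [Fintype.card_perm, ← Nat.cast_smul_eq_nsmul 𝕜, smul_smul, h]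

namespace ContinuousPolynomial

/-- The polynomial `x ↦ φ x ^ n • y`. -/
def powSMulConst (n : ℕ) (φ : StrongDual 𝕜 E) (y : F) : ContinuousPolynomial 𝕜 n E F :=
  ⟨fun x => φ x ^ n • y, by
    convert (((MultilinearMap.mkPiAlgebra 𝕜 (Fin n) 𝕜).compLinearMap
      fun _ => (φ : E →ₗ[𝕜] 𝕜)).smulRight y).isHomogeneousPolynomial
    simp, by fun_prop⟩

/-- The polynomial `x ↦ φ x ^ n • T x`. -/
def powSMul (n : ℕ) (φ : StrongDual 𝕜 E) (T : E →L[𝕜] F) : ContinuousPolynomial 𝕜 (n + 1) E F :=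
  ⟨fun x => φ x ^ n • T x, by
    let N := (MultilinearMap.mkPiAlgebra 𝕜 (Fin n) 𝕜).compLinearMap fun _ => (φ : E →ₗ[𝕜] 𝕜)
    let L : E →ₗ[𝕜] MultilinearMap 𝕜 (fun _ : Fin n => E) F :=
      { toFun := fun z => N.smulRight (T z)
        map_add' := fun z w => by ext; simp
        map_smul' := fun c z => by ext; simp [smul_comm c] }
    convert (LinearMap.uncurryLeft (M := fun _ : Fin (n + 1) => E) L).isHomogeneousPolynomial
    simp [L, N, Fin.tail_def], by fun_prop⟩

@[simp] theorem powSMulConst_apply (φ : StrongDual 𝕜 E) (y : F) (x : E) :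
    powSMulConst n φ y x = φ x ^ n • y := rfl

@[simp] theorem powSMul_apply (φ : StrongDual 𝕜 E) (T : E →L[𝕜] F) (x : E) :
    powSMul n φ T x = φ x ^ n • T x := rfl

theorem norm_powSMulConst_le {φ : StrongDual 𝕜 E} (hφ : ‖φ‖ ≤ 1) {y : F} (hy : ‖y‖ ≤ 1) :
    ‖powSMulConst n φ y‖ ≤ 1 :=
  norm_le fun x hx => by
    rw [powSMulConst_apply, norm_smul, norm_pow]
    exact mul_le_one₀ (pow_le_one₀ (norm_nonneg _) ((φ.unit_le_opNorm x hx).trans hφ))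
      (norm_nonneg _) hy

theorem norm_powSMul_le {φ : StrongDual 𝕜 E} (hφ : ‖φ‖ ≤ 1) {T : E →L[𝕜] F} (hT : ‖T‖ ≤ 1) :
    ‖powSMul n φ T‖ ≤ 1 :=
  norm_le fun x hx => by
    rw [powSMul_apply, norm_smul, norm_pow]
    exact mul_le_one₀ (pow_le_one₀ (norm_nonneg _) ((φ.unit_le_opNorm x hx).trans hφ))
      (norm_nonneg _) ((T.unit_le_opNorm x hx).trans hT)

theorem powSMulConst_mem (φ : StrongDual 𝕜 E) (y : F) :
    powSMulConst n φ y ∈ weaklyContinuousOnBounded 𝕜 n E F :=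
  fun _ x₀ _ hl => ⟨φ x₀ ^ n • y, ((tendsto_toWeakSpace_iff.1 hl φ).pow n).smul_const y⟩

theorem exists_tendsto_of_mem [CompleteSpace F] {P : ContinuousPolynomial 𝕜 n E F}
    (hP : P ∈ weaklyContinuousOnBounded 𝕜 n E F) {l : Filter E} [l.NeBot] {r : ℝ}
    (hl : ∀ᶠ x in l, ‖x‖ ≤ r) (hc : ∀ φ : StrongDual 𝕜 E, Cauchy (l.map φ)) :
    ∃ q : F, Tendsto P l (𝓝 q) :=
  CompleteSpace.complete
    (WeaklyContinuousOnBounded.cauchy_map (𝕜 := 𝕜) hP P.hasDifferenceDegreeLE hl hc)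

theorem exists_dual_tendsto (n : ℕ) (U : Ultrafilter E) (hU : ∀ᶠ x in (U : Filter E), ‖x‖ ≤ 1)
    (g : StrongDual 𝕜 F) : ∃ f : StrongDual 𝕜 (ContinuousPolynomial 𝕜 n E F), ‖f‖ ≤ ‖g‖ ∧
      ∀ P : ContinuousPolynomial 𝕜 n E F, Tendsto (fun x => g (P x)) U (𝓝 (f P)) := by
  have hb : ∀ P : ContinuousPolynomial 𝕜 n E F,
      ∀ᶠ x in (U : Filter E), g (P x) ∈ closedBall (0 : 𝕜) (‖g‖ * ‖P‖) := fun P => by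
    filter_upwards [hU] with x hx
    rw [mem_closedBall_zero_iff]
    exact (g.le_opNorm _).trans (by gcongr; exact P.norm_apply_le hx)
  have hlim : ∀ P : ContinuousPolynomial 𝕜 n E F, ∃ c ∈ closedBall (0 : 𝕜) (‖g‖ * ‖P‖),
      Tendsto (fun x => g (P x)) U (𝓝 c) := fun P =>
    (isCompact_closedBall (0 : 𝕜) (‖g‖ * ‖P‖)).ultrafilter_le_nhds
      (U.map fun x => g (P x)) (le_principal_iff.2 (hb P))
  choose f hf hft using hlim
  let f' : ContinuousPolynomial 𝕜 n E F →ₗ[𝕜] 𝕜 :=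
    { toFun := f
      map_add' := fun P R => tendsto_nhds_unique (hft (P + R)) (by
        simpa using (hft P).add (hft R))
      map_smul' := fun c P => tendsto_nhds_unique (hft (c • P)) (by
        simpa using (hft P).const_mul c) }
  refine ⟨f'.mkContinuous ‖g‖ fun P => mem_closedBall_zero_iff.1 (hf P),
    f'.mkContinuous_norm_le (norm_nonneg g) _, hft⟩

end ContinuousPolynomial

theorem IsQuotientMapping.norm_le_one {ρ : E →L[𝕜] F} (hρ : IsQuotientMapping ρ) : ‖ρ‖ ≤ 1 :=
  ρ.opNorm_le_bound zero_le_one fun x => by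
    rw [one_mul]
    exact NormedAddGroupHom.IsQuotient.norm_le hρ x

/-- A Goldstine ultrafilter lives on the open unit ball of $F$, whose points lift to points of norm
less than 1 because the norm of $F$ is the quotient norm. -/
theorem IsQuotientMapping.exists_ultrafilter_tendsto {ρ : E →L[𝕜] F} (hρ : IsQuotientMapping ρ)
    (Φ : StrongDual 𝕜 (StrongDual 𝕜 F)) (hΦ : ‖Φ‖ ≤ 1) :
    ∃ U : Ultrafilter E, (∀ᶠ x in (U : Filter E), ‖x‖ ≤ 1) ∧
      ∀ g : StrongDual 𝕜 F, Tendsto (fun x => g (ρ x)) U (𝓝 (Φ g)) := by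
  obtain ⟨V, hV, hVΦ⟩ := exists_ultrafilter_tendsto_bidual Φ hΦ
  have hlift : ∀ w : F, ∃ x : E, ρ x = w ∧ (‖w‖ < 1 → ‖x‖ < 1) := fun w => by
    by_cases hw : ‖w‖ < 1
    · obtain ⟨x, hx, hxw⟩ := NormedAddGroupHom.IsQuotient.norm_lift hρ (sub_pos.2 hw) w
      exact ⟨x, hx, fun _ => by linarith⟩
    · obtain ⟨x, hx⟩ := NormedAddGroupHom.IsQuotient.surjective hρ w
      exact ⟨x, hx, fun h => absurd h hw⟩
  choose s hs hs1 using hlift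
  refine ⟨V.map s, ?_, fun g => ?_⟩
  · rw [Ultrafilter.coe_map, eventually_map]
    filter_upwards [hV] with w hw using (hs1 w hw).le
  · rw [Ultrafilter.coe_map, tendsto_map'_iff]
    simpa [Function.comp_def, hs] using hVΦ g

open ContinuousPolynomial NormedSpace

variable [CompleteSpace F]

theorem exists_norm_pow_smul_add_sub_le {ρ : E →L[𝕜] F} (hρ : IsQuotientMapping ρ)
    (h : IsMIdeal 𝕜 (ContinuousPolynomial 𝕜 (n + 1) E F)
      (weaklyContinuousOnBounded 𝕜 (n + 1) E F))
    (Φ : StrongDual 𝕜 (StrongDual 𝕜 F)) (hΦ : ‖Φ‖ = 1) {y : F} (hy : ‖y‖ ≤ 1)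
    (g : StrongDual 𝕜 F) {φ : StrongDual 𝕜 F} (hφ : ‖φ‖ ≤ 1) {ε : ℝ} (hε : 0 < ε) :
    ∃ q : F, ‖Φ φ ^ (n + 1) • inclusionInDoubleDual 𝕜 F y + Φ φ ^ n • Φ -
      inclusionInDoubleDual 𝕜 F q‖ ≤ 1 + ε ∧ ‖g q - Φ φ ^ n * Φ g‖ ≤ ε := by
  obtain ⟨-, Q, hQ, hM⟩ := h
  obtain ⟨U, hU, hUΦ⟩ := hρ.exists_ultrafilter_tendsto Φ hΦ.le
  obtain ⟨f, hfg, hf⟩ := exists_dual_tendsto (n + 1) U hU g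
  have hcomp : ∀ ψ : StrongDual 𝕜 F, ‖ψ‖ ≤ 1 → ‖ψ.comp ρ‖ ≤ 1 := fun ψ hψ =>
    (ψ.opNorm_comp_le ρ).trans (mul_le_one₀ hψ (norm_nonneg _) hρ.norm_le_one)
  -- `f - Q f` vanishes on $\mathcal P_w$, and the polynomials $(\psi\circ\rho)^{n+1}z$ with
  -- $\Phi(\psi)$ near 1 show that `f` has norm at least `‖g‖` there. Thus $\|Qf\|\ge\|g\|\ge\|f\|$,
  -- and additivity of the norm leaves nothing for `f - Q f`.
  have hQf : Q f = f := by
    have hle : ‖g‖ ≤ ‖Q f‖ := by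
      refine opNorm_le_of_re_le g fun z hz => (RCLike.re_le_norm _).trans ?_
      have ht : ∀ t : ℝ, 0 ≤ t → t < 1 → t ^ (n + 1) * ‖g z‖ ≤ ‖Q f‖ := fun t ht0 ht1 => by
        obtain ⟨ψ, hψ, s, hts, hs⟩ :=
          exists_apply_eq_ofReal_of_lt_opNorm Φ (ht1.trans_eq hΦ.symm)
        let P : ContinuousPolynomial 𝕜 (n + 1) E F := powSMulConst (n + 1) (ψ.comp ρ) z
        have hP : (f - Q f) P = 0 :=
          (hQ.ker_eq (f - Q f)).1 (by rw [map_sub, hQ.proj, sub_self]) P (powSMulConst_mem _ _)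
        have hfP : f P = (s : 𝕜) ^ (n + 1) * g z := by
          refine tendsto_nhds_unique (hf P) ?_
          simpa [P, hs] using ((hUΦ ψ).pow (n + 1)).mul_const (g z)
        rw [sub_apply, sub_eq_zero, hfP] at hP
        calc t ^ (n + 1) * ‖g z‖ ≤ s ^ (n + 1) * ‖g z‖ := by gcongr
          _ = ‖Q f P‖ := by
            rw [← hP, norm_mul, norm_pow, RCLike.norm_ofReal, abs_of_nonneg (by linarith)]
          _ ≤ ‖Q f‖ := (Q f).unit_le_opNorm P (norm_powSMulConst_le (hcomp ψ hψ.le) hz.le)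
      have hlim : Tendsto (fun t : ℝ => t ^ (n + 1) * ‖g z‖) (𝓝[<] 1) (𝓝 ‖g z‖) := by
        have : Continuous fun t : ℝ => t ^ (n + 1) * ‖g z‖ := by fun_prop
        simpa using (this.tendsto 1).mono_left nhdsWithin_le_nhds
      refine le_of_tendsto hlim ?_
      filter_upwards [Ioo_mem_nhdsLT (zero_lt_one (α := ℝ))] with t h using ht t h.1.le h.2
    have := hM f
    exact (sub_eq_zero.1 (norm_le_zero_iff.1 (by linarith))).symm
  obtain ⟨R, hR, hRn, hRf⟩ := hQ.exists_norm_add_sub_lt hM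
    (x := powSMul n (φ.comp ρ) ρ) (y := powSMulConst (n + 1) (φ.comp ρ) y)
    (norm_powSMul_le (hcomp φ hφ) hρ.norm_le_one) (norm_powSMulConst_le (hcomp φ hφ) hy)
    (powSMulConst_mem _ _) f hε
  -- A bounded ultrafilter is weakly Cauchy because closed balls of the scalar field are compact.
  have hUc : ∀ ψ : StrongDual 𝕜 E, Cauchy ((U : Filter E).map ψ) := fun ψ => by
    obtain ⟨c, -, hc⟩ := (isCompact_closedBall (0 : 𝕜) ‖ψ‖).ultrafilter_le_nhds (U.map ψ)
      (le_principal_iff.2 (show ∀ᶠ x in (U : Filter E), ψ x ∈ closedBall (0 : 𝕜) ‖ψ‖ by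
        filter_upwards [hU] with x hx
        simpa using ψ.unit_le_opNorm x hx))
    exact cauchy_nhds.mono hc
  obtain ⟨q, hq⟩ := exists_tendsto_of_mem hR hU hUc
  have hfq : f R = g q := tendsto_nhds_unique (hf R) ((g.continuous.tendsto q).comp hq)
  have hfP : f (powSMul n (φ.comp ρ) ρ) = Φ φ ^ n * Φ g := by
    refine tendsto_nhds_unique (hf _) ?_
    simpa using ((hUΦ φ).pow n).mul (hUΦ g)
  refine ⟨q, ?_, by rw [hQf, hfq, hfP] at hRf; exact hRf.le⟩
  -- The norm in the bidual is tested on each `ψ`: the bound on the polynomial passes to the limit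
  -- along `U`.
  refine opNorm_le_of_re_le _ fun ψ hψ => (RCLike.re_le_norm _).trans ?_
  have hlim : Tendsto (fun x => ψ ((powSMulConst (n + 1) (φ.comp ρ) y +
      powSMul n (φ.comp ρ) ρ - R) x)) U
      (𝓝 (Φ φ ^ (n + 1) * ψ y + Φ φ ^ n * Φ ψ - ψ q)) := by
    have := ((((hUΦ φ).pow (n + 1)).mul_const (ψ y)).add (((hUΦ φ).pow n).mul (hUΦ ψ))).sub
      ((ψ.continuous.tendsto q).comp hq)
    refine this.congr fun x => ?_
    change _ = ψ (φ (ρ x) ^ (n + 1) • y + φ (ρ x) ^ n • ρ x - R x)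
    simp
  have hle : ‖Φ φ ^ (n + 1) * ψ y + Φ φ ^ n * Φ ψ - ψ q‖ ≤ 1 + ε := by
    refine le_of_tendsto hlim.norm ?_
    filter_upwards [hU] with x hx
    refine (ψ.le_opNorm _).trans ((mul_le_of_le_one_left (norm_nonneg _) hψ.le).trans ?_)
    exact (norm_apply_le _ hx).trans hRn.le
  simpa using hle

set_option maxSynthPendingDepth 6 in
theorem exists_norm_add_sub_le {ρ : E →L[𝕜] F} (hρ : IsQuotientMapping ρ)
    (h : IsMIdeal 𝕜 (ContinuousPolynomial 𝕜 (n + 1) E F)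
      (weaklyContinuousOnBounded 𝕜 (n + 1) E F))
    (Φ : StrongDual 𝕜 (StrongDual 𝕜 F)) (hΦ : ‖Φ‖ = 1) {y : F} (hy : ‖y‖ ≤ 1)
    (g : StrongDual 𝕜 F) {ε : ℝ} (hε : 0 < ε) :
    ∃ q : F, ‖inclusionInDoubleDual 𝕜 F y + Φ - inclusionInDoubleDual 𝕜 F q‖ ≤ 1 + ε ∧
      ‖g q - Φ g‖ ≤ ε := by
  have hpow : ∀ m : ℕ, ∀ᶠ t in 𝓝 (1 : ℝ), |t ^ m - 1| * (1 + ‖g‖) < ε / 3 := fun m => by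
    have : Continuous fun t : ℝ => |t ^ m - 1| * (1 + ‖g‖) := by fun_prop
    exact (this.tendsto 1).eventually (gt_mem_nhds (by simpa using hε))
  obtain ⟨δ, hδ, hδt⟩ := Metric.eventually_nhds_iff.1 ((hpow (n + 1)).and (hpow n))
  -- Since $\|\Phi\|=1$, the value $\Phi(\varphi)=t$ can be taken so close to 1 that replacing
  -- $t^{n+1}$ and $t^n$ by 1 costs at most $\varepsilon/3$ each.
  obtain ⟨φ, hφ, t, ht, hφt⟩ :=
    exists_apply_eq_ofReal_of_lt_opNorm Φ (show 1 - δ < ‖Φ‖ by linarith)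
  have ht1 : t ≤ 1 := by
    have := Φ.unit_le_opNorm φ hφ.le
    rw [hφt, RCLike.norm_ofReal, hΦ] at this
    exact (le_abs_self t).trans this
  obtain ⟨h1, h2⟩ := @hδt t (by rw [Real.dist_eq, abs_lt]; constructor <;> linarith)
  have hn (m : ℕ) : ‖(t : 𝕜) ^ m - 1‖ = |t ^ m - 1| := by
    rw [← RCLike.norm_ofReal (K := 𝕜)]
    push_cast
    rfl
  obtain ⟨q, hq1, hq2⟩ := exists_norm_pow_smul_add_sub_le hρ h Φ hΦ hy g hφ.le
    (show 0 < ε / 3 by linarith)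
  rw [hφt] at hq1 hq2
  have hb (m : ℕ) (hm : |t ^ m - 1| * (1 + ‖g‖) < ε / 3) {r : ℝ} (hr : r ≤ 1 + ‖g‖) :
      ‖(t : 𝕜) ^ m - 1‖ * r ≤ ε / 3 := by
    rw [hn]
    exact (mul_le_mul_of_nonneg_left hr (abs_nonneg _)).trans hm.le
  have hg := norm_nonneg g
  refine ⟨q, ?_, ?_⟩
  · have hy' := hb (n + 1) h1 ((double_dual_bound 𝕜 F y).trans (by linarith))
    have hΦ' : ‖(t : 𝕜) ^ n - 1‖ * ‖Φ‖ ≤ ε / 3 := hb n h2 (by linarith)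
    rw [← norm_smul] at hy' hΦ'
    calc ‖inclusionInDoubleDual 𝕜 F y + Φ - inclusionInDoubleDual 𝕜 F q‖
        = ‖((t : 𝕜) ^ (n + 1) • inclusionInDoubleDual 𝕜 F y + (t : 𝕜) ^ n • Φ -
            inclusionInDoubleDual 𝕜 F q) - (((t : 𝕜) ^ (n + 1) - 1) • inclusionInDoubleDual 𝕜 F y +
            ((t : 𝕜) ^ n - 1) • Φ)‖ := by congr 1; module
      _ ≤ (1 + ε / 3) + (ε / 3 + ε / 3) :=
        (norm_sub_le _ _).trans (add_le_add hq1 ((norm_add_le _ _).trans (add_le_add hy' hΦ')))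
      _ = 1 + ε := by ring
  · have hΦg := Φ.le_opNorm g
    rw [hΦ, one_mul] at hΦg
    have hΦ' : ‖(t : 𝕜) ^ n - 1‖ * ‖Φ g‖ ≤ ε / 3 := hb n h2 (by linarith)
    rw [← norm_smul] at hΦ'
    calc ‖g q - Φ g‖ = ‖(g q - (t : 𝕜) ^ n * Φ g) + ((t : 𝕜) ^ n - 1) • Φ g‖ := by
          congr 1; rw [smul_eq_mul]; ring
      _ ≤ ε / 3 + ε / 3 := (norm_add_le _ _).trans (add_le_add hq2 hΦ')
      _ ≤ ε := by linarith

end HomogeneousPolynomials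

/-! ### The $L$-decomposition of the third dual -/

section Bidual

open NormedSpace

variable {𝕜 : Type*} [RCLike 𝕜] {F : Type*} [NormedAddCommGroup F] [NormedSpace 𝕜 F]

set_option maxSynthPendingDepth 6 in
-- Test the sum on $w=y+\Phi-q$, where $y$ nearly norms $g$ and $\Phi$ nearly norms $k$. As $k$
-- kills $y$ and $q$, the value is $g(y)+k(\Phi)+(\Phi(g)-g(q))$, nearly $\|g\|+\|k\|$, while
-- $\|w\|\le 1+\varepsilon$.
theorem norm_add_norm_le_of_exists_norm_add_sub_le
    (h : ∀ Φ : StrongDual 𝕜 (StrongDual 𝕜 F), ‖Φ‖ = 1 → ∀ y : F, ‖y‖ ≤ 1 →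
      ∀ (g : StrongDual 𝕜 F) (ε : ℝ), 0 < ε → ∃ q : F,
        ‖inclusionInDoubleDual 𝕜 F y + Φ - inclusionInDoubleDual 𝕜 F q‖ ≤ 1 + ε ∧
          ‖g q - Φ g‖ ≤ ε)
    (g : StrongDual 𝕜 F) (k : StrongDual 𝕜 (StrongDual 𝕜 (StrongDual 𝕜 F)))
    (hk : ∀ y, k (inclusionInDoubleDual 𝕜 F y) = 0) :
    ‖g‖ + ‖k‖ ≤ ‖inclusionInDoubleDual 𝕜 (StrongDual 𝕜 F) g + k‖ := by
  set f := inclusionInDoubleDual 𝕜 (StrongDual 𝕜 F) g + k with hf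
  rcases eq_or_ne k 0 with rfl | hk0
  · rw [hf, norm_zero, add_zero, add_zero]
    exact ((inclusionInDoubleDualLi 𝕜 (E := StrongDual 𝕜 F)).norm_map g).ge
  have hk0' : 0 < ‖k‖ := norm_pos_iff.2 hk0
  -- The loss $3\varepsilon$ is one $\varepsilon$ each for $g(y)$, $k(\Phi)$ and $g(q)-\Phi(g)$;
  -- $\varepsilon<\|k\|$ keeps `Ψ` nonzero, so that it can be normalised.
  have key : ∀ ε : ℝ, 0 < ε → ε < ‖k‖ → ‖g‖ + ‖k‖ - 3 * ε ≤ ‖f‖ * (1 + ε) := by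
    intro ε hε hεk
    obtain ⟨y, hy, a, ha, hya⟩ :=
      exists_apply_eq_ofReal_of_lt_opNorm g (show ‖g‖ - ε < ‖g‖ by linarith)
    obtain ⟨Ψ, hΨ, b, hb, hΨb⟩ :=
      exists_apply_eq_ofReal_of_lt_opNorm k (show ‖k‖ - ε < ‖k‖ by linarith)
    have hb0 : 0 < b := by linarith
    have hΨ0 : 0 < ‖Ψ‖ := norm_pos_iff.2 fun h0 => by
      rw [h0, map_zero] at hΨb
      exact hb0.ne (by exact_mod_cast hΨb)
    let Φ : StrongDual 𝕜 (StrongDual 𝕜 F) := ((‖Ψ‖⁻¹ : ℝ) : 𝕜) • Ψ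
    have hΦ : ‖Φ‖ = 1 := by
      rw [norm_smul, RCLike.norm_ofReal, abs_of_pos (by positivity), inv_mul_cancel₀ hΨ0.ne']
    have hkΦ : k Φ = ((‖Ψ‖⁻¹ * b : ℝ) : 𝕜) := by
      rw [map_smul, hΨb, smul_eq_mul, RCLike.ofReal_mul]
    have hb' : b ≤ ‖Ψ‖⁻¹ * b := le_mul_of_one_le_left hb0.le ((one_le_inv₀ hΨ0).2 hΨ.le)
    obtain ⟨q, hq, hgq⟩ := h Φ hΦ y hy.le g ε hε
    set w := inclusionInDoubleDual 𝕜 F y + Φ - inclusionInDoubleDual 𝕜 F q with hw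
    have hfw : f w = ((a + ‖Ψ‖⁻¹ * b : ℝ) : 𝕜) - (g q - Φ g) := by
      have h1 : f w = (g y + Φ g - g q) + k w := rfl
      rw [h1, hw, map_sub, map_add, hk, hk, hkΦ, hya]
      push_cast
      ring
    have h2 : a + ‖Ψ‖⁻¹ * b ≤ ‖f w‖ + ε := by
      have h3 : ‖((a + ‖Ψ‖⁻¹ * b : ℝ) : 𝕜)‖ = ‖f w + (g q - Φ g)‖ := by rw [hfw]; congr 1; ring
      rw [RCLike.norm_ofReal] at h3
      linarith [le_abs_self (a + ‖Ψ‖⁻¹ * b), norm_add_le (f w) (g q - Φ g)]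
    have h4 : ‖f w‖ ≤ ‖f‖ * (1 + ε) :=
      (f.le_opNorm w).trans (mul_le_mul_of_nonneg_left hq (norm_nonneg _))
    linarith
  have hlim1 : Tendsto (fun ε : ℝ => ‖g‖ + ‖k‖ - 3 * ε) (𝓝[>] 0) (𝓝 (‖g‖ + ‖k‖)) := by
    have : Continuous fun ε : ℝ => ‖g‖ + ‖k‖ - 3 * ε := by fun_prop
    simpa using (this.tendsto 0).mono_left nhdsWithin_le_nhds
  have hlim2 : Tendsto (fun ε : ℝ => ‖f‖ * (1 + ε)) (𝓝[>] 0) (𝓝 ‖f‖) := by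
    have : Continuous fun ε : ℝ => ‖f‖ * (1 + ε) := by fun_prop
    simpa using (this.tendsto 0).mono_left nhdsWithin_le_nhds
  refine le_of_tendsto_of_tendsto hlim1 hlim2 ?_
  filter_upwards [Ioo_mem_nhdsGT hk0'] with ε hε using key ε hε.1 hε.2

set_option maxSynthPendingDepth 6 in
theorem isMIdeal_range_inclusionInDoubleDual [CompleteSpace F]
    (h : ∀ Φ : StrongDual 𝕜 (StrongDual 𝕜 F), ‖Φ‖ = 1 → ∀ y : F, ‖y‖ ≤ 1 →
      ∀ (g : StrongDual 𝕜 F) (ε : ℝ), 0 < ε → ∃ q : F,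
        ‖inclusionInDoubleDual 𝕜 F y + Φ - inclusionInDoubleDual 𝕜 F q‖ ≤ 1 + ε ∧
          ‖g q - Φ g‖ ≤ ε) :
    IsMIdeal 𝕜 (StrongDual 𝕜 (StrongDual 𝕜 F))
      (LinearMap.range (inclusionInDoubleDual 𝕜 F).toLinearMap) := by
  have hnorm (g : StrongDual 𝕜 F) : ‖inclusionInDoubleDual 𝕜 (StrongDual 𝕜 F) g‖ = ‖g‖ :=
    (inclusionInDoubleDualLi 𝕜 (E := StrongDual 𝕜 F)).norm_map g
  let restr : StrongDual 𝕜 (StrongDual 𝕜 (StrongDual 𝕜 F)) →L[𝕜] StrongDual 𝕜 F :=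
    (ContinuousLinearMap.compL 𝕜 F (StrongDual 𝕜 (StrongDual 𝕜 F)) 𝕜).flip
      (inclusionInDoubleDual 𝕜 F)
  have hrestr (f y) : restr f y = f (inclusionInDoubleDual 𝕜 F y) := rfl
  have hrestr_le (f) : ‖restr f‖ ≤ ‖f‖ :=
    (f.opNorm_comp_le _).trans
      (mul_le_of_le_one_right (norm_nonneg _) (inclusionInDoubleDual_norm_le 𝕜 F))
  let Q := (inclusionInDoubleDual 𝕜 (StrongDual 𝕜 F)).comp restr
  have hQ (f) : Q f = inclusionInDoubleDual 𝕜 (StrongDual 𝕜 F) (restr f) := rfl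
  have hQapp (f y) : Q f (inclusionInDoubleDual 𝕜 F y) = f (inclusionInDoubleDual 𝕜 F y) := rfl
  refine ⟨?_, Q, ⟨fun f => ?_, ?_, fun f => ?_⟩, fun f => le_antisymm ?_ ?_⟩
  · exact (inclusionInDoubleDualLi 𝕜 (E := F)).isometry.isClosedEmbedding.isClosed_range
  · rw [hQ, hQ]
    rfl
  · refine Q.opNorm_le_bound zero_le_one fun f => ?_
    rw [hQ, hnorm, one_mul]
    exact hrestr_le f
  · rw [← norm_eq_zero, hQ, hnorm, norm_eq_zero]
    constructor
    · rintro h0 _ ⟨y, rfl⟩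
      exact (DFunLike.congr_fun h0 y)
    · exact fun h0 => ContinuousLinearMap.ext fun y => h0 _ ⟨y, rfl⟩
  · exact (norm_add_le _ _).trans_eq' (by rw [add_sub_cancel])
  · have := norm_add_norm_le_of_exists_norm_add_sub_le h (restr f) (f - Q f) fun y => by
      rw [sub_apply, hQapp, sub_self]
    rwa [← hQ, add_sub_cancel, ← hnorm, ← hQ] at this

end Bidual

/-- If `F` is the image of `E` under a quotient mapping and `𝓟_w(ⁿE, F)` is an `M`-ideal in
`𝓟(ⁿE, F)` for some `n ≥ 1`, then `F` is an `M`-ideal in its bidual. -/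
theorem corollary4p7 {𝕜 : Type*} [RCLike 𝕜]
    {E : Type*} [NormedAddCommGroup E] [NormedSpace 𝕜 E] [CompleteSpace E]
    {F : Type*} [NormedAddCommGroup F] [NormedSpace 𝕜 F] [CompleteSpace F]
    (ρ : E →L[𝕜] F) (hρ : IsQuotientMapping ρ)
    (h : ∃ n : ℕ, 1 ≤ n ∧ IsMIdeal 𝕜 (ContinuousPolynomial 𝕜 n E F)
      (ContinuousPolynomial.weaklyContinuousOnBounded 𝕜 n E F)) :
    IsMIdeal 𝕜 (StrongDual 𝕜 (StrongDual 𝕜 F))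
      (LinearMap.range (NormedSpace.inclusionInDoubleDual 𝕜 F).toLinearMap) := by
  obtain ⟨n, hn, hM⟩ := h
  -- The degree is at least 1 because the polynomial $(\varphi\circ\rho)^m\rho$ spends one degree on
  -- $\rho$.
  obtain ⟨m, rfl⟩ := Nat.exists_eq_add_of_le' hn
  exact isMIdeal_range_inclusionInDoubleDual fun Φ hΦ y hy g ε hε =>
    exists_norm_add_sub_le hρ hM Φ hΦ hy g hε
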